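/- Let $n\ge 1$ and $d\ge 0$ be integers, let $V=\mathbb{Q}^n$, and let $S(n,d)=\operatorname{End}_{\Sigma_d}(V^{\otimes d})$ be the Schur algebra over $\mathbb{Q}$, i.e. the algebra of all linear endomorphisms of $V^{\otimes d}$ that commute with the action of the symmetric group $\Sigma_d$ by permutation of the tensor places. The Lie algebra $\mathfrak{gl}_n$ of $n\times n$ matrices over $\mathbb{Q}$ acts on $V^{\otimes d}$ by $A\mapsto\sum_{k=1}^{d}1^{\otimes (k-1)}\otimes A\otimes 1^{\otimes (d-k)}$, which gives an algebra homomorphism $U(\mathfrak{gl}_n)\to S(n,d)$; elements of $U(\mathfrak{gl}_n)$ are identified with their images in $S(n,d)$. Write $E_{ij}$ for the matrix units, let $\Phi=\{\varepsilon_i-\varepsilon_j\mid 1\le i\ne j\le n\}$, and put $x_\alpha=E_{ij}$ for $\alpha=\varepsilon_i-\varepsilon_j\in\Phi$ and $H_k=E_{kk}$ for $1\le k\le n$. Fix an integer $k_0$ with $1\le k_0\le n$, set $$G=\{x_\alpha\mid\alpha\in\Phi\}\cup\{H_k\mid k\in\{1,\dots,n\},\ k\ne k_0\},$$ and fix any total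 order $g_1<g_2<\dots<g_N$ on this set of $N=n^2-1$ generators. Then the monomials $$g_1^{a_1}g_2^{a_2}\cdots g_N^{a_N},\qquad a_1,\dots,a_N\in\mathbb{Z}_{\ge 0},\quad a_1+\dots+a_N\le d,$$ which are pairwise distinct as elements of $S(n,d)$, form a basis of $S(n,d)$ over $\mathbb{Q}$. -/

import Mathlib

open scoped TensorProduct

noncomputable section

attribute [local instance 100] LieRing.ofAssociativeRing

/-- The tensor space `V^{⊗ d}`, where `V = ℚ^n`. -/
abbrev TensorSpace (n d : ℕ) : Type := ⨂[ℚ] _ : Fin d, (Fin n → ℚ)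

/-- The action of `σ ∈ Σ_d` on `V^{⊗ d}` by permutation of the tensor places. -/
def placePerm (n d : ℕ) (σ : Equiv.Perm (Fin d)) : Module.End ℚ (TensorSpace n d) :=
  (PiTensorProduct.reindex ℚ (fun _ : Fin d => Fin n → ℚ) σ).toLinearMap

/-- The Schur algebra `S(n,d) = End_{Σ_d}(V^{⊗ d})` over `ℚ`: the endomorphisms of tensor space
that commute with all place permutations. -/
def SchurAlgebra (n d : ℕ) : Subalgebra ℚ (Module.End ℚ (TensorSpace n d)) :=
  Subalgebra.centralizer ℚ (Set.range (placePerm n d))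

/-- The usual ring structure of a subalgebra (instance search needs help to find it here). -/
instance (n d : ℕ) : Ring (SchurAlgebra n d) :=
  @Subalgebra.toRing ℚ (Module.End ℚ (TensorSpace n d)) _ _ _ (SchurAlgebra n d)

/-- `1 ⊗ ⋯ ⊗ 1 ⊗ f ⊗ 1 ⊗ ⋯ ⊗ 1`, with `f` in the `k`-th place. -/
def actAt (n d : ℕ) (k : Fin d) (f : Module.End ℚ (Fin n → ℚ)) :
    Module.End ℚ (TensorSpace n d) :=
  PiTensorProduct.map (Function.update (fun _ : Fin d => LinearMap.id) k f)

theorem actAt_tprod (n d : ℕ) (k : Fin d) (f : Module.End ℚ (Fin n → ℚ))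
    (v : Fin d → Fin n → ℚ) :
    actAt n d k f (PiTensorProduct.tprod ℚ v)
      = PiTensorProduct.tprod ℚ (Function.update v k (f (v k))) := by
  rw [actAt, PiTensorProduct.map_tprod]
  congr 1
  funext i
  by_cases h : i = k
  · subst h; simp
  · simp [h]

theorem actAt_add (n d : ℕ) (k : Fin d) (f g : Module.End ℚ (Fin n → ℚ)) :
    actAt n d k (f + g) = actAt n d k f + actAt n d k g := by
  apply PiTensorProduct.ext
  refine MultilinearMap.ext fun v => ?_
  simp [actAt_tprod, MultilinearMap.map_update_add]

theorem actAt_smul (n d : ℕ) (k : Fin d) (c : ℚ) (f : Module.End ℚ (Fin n → ℚ)) :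
    actAt n d k (c • f) = c • actAt n d k f := by
  apply PiTensorProduct.ext
  refine MultilinearMap.ext fun v => ?_
  simp [actAt_tprod, MultilinearMap.map_update_smul]

theorem actAt_mul (n d : ℕ) (k : Fin d) (f g : Module.End ℚ (Fin n → ℚ)) :
    actAt n d k f * actAt n d k g = actAt n d k (f * g) := by
  apply PiTensorProduct.ext
  refine MultilinearMap.ext fun v => ?_
  simp [actAt_tprod]

theorem actAt_comm (n d : ℕ) {k l : Fin d} (h : k ≠ l) (f g : Module.End ℚ (Fin n → ℚ)) :
    actAt n d k f * actAt n d l g = actAt n d l g * actAt n d k f := by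
  apply PiTensorProduct.ext
  refine MultilinearMap.ext fun v => ?_
  simp [actAt_tprod, h, h.symm, Function.update_comm h]

/-- The diagonal (derivation) action of `A ∈ 𝔤𝔩_n` on `V^{⊗ d}`:
`A ↦ ∑_k 1 ⊗ ⋯ ⊗ A ⊗ ⋯ ⊗ 1`. -/
def diagAct (n d : ℕ) (A : Matrix (Fin n) (Fin n) ℚ) : Module.End ℚ (TensorSpace n d) :=
  ∑ k : Fin d, actAt n d k (Matrix.toLin' A)

theorem diagAct_mem (n d : ℕ) (A : Matrix (Fin n) (Fin n) ℚ) :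
    diagAct n d A ∈ SchurAlgebra n d := by
  rw [SchurAlgebra, Subalgebra.mem_centralizer_iff]
  rintro _ ⟨σ, rfl⟩
  apply PiTensorProduct.ext
  refine MultilinearMap.ext fun v => ?_
  have hr : ∀ w : Fin d → Fin n → ℚ, placePerm n d σ (PiTensorProduct.tprod ℚ w)
      = PiTensorProduct.tprod ℚ (fun i => w (σ.symm i)) := fun w => by
    simp [placePerm, PiTensorProduct.reindex_tprod]
  simp only [LinearMap.compMultilinearMap_apply, Module.End.mul_apply, diagAct,
    LinearMap.sum_apply, actAt_tprod, map_sum, hr]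
  refine Fintype.sum_equiv σ _ _ fun k => ?_
  congr 1
  funext i
  by_cases h : i = σ k
  · subst h; simp
  · have h' : σ.symm i ≠ k := fun e => h (by rw [← e]; simp)
    simp [h, h']

theorem diagAct_lie (n d : ℕ) (A B : Matrix (Fin n) (Fin n) ℚ) :
    diagAct n d ⁅A, B⁆ + diagAct n d B * diagAct n d A = diagAct n d A * diagAct n d B := by
  have e : diagAct n d B * diagAct n d A = ∑ k : Fin d, ∑ l : Fin d,
      actAt n d l (Matrix.toLin' B) * actAt n d k (Matrix.toLin' A) := by
    simp only [diagAct, Finset.sum_mul_sum]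
    exact Finset.sum_comm
  rw [e]
  simp only [diagAct, Finset.sum_mul_sum]
  rw [← Finset.sum_add_distrib]
  refine Finset.sum_congr rfl fun k _ => ?_
  rw [← Finset.add_sum_erase _ _ (Finset.mem_univ k),
    ← Finset.add_sum_erase _ (fun l => actAt n d k _ * actAt n d l _) (Finset.mem_univ k),
    ← add_assoc, actAt_mul, actAt_mul, ← actAt_add]
  congr 1
  · congr 1
    rw [Ring.lie_def, map_sub, Matrix.toLin'_mul, Matrix.toLin'_mul]
    exact sub_add_cancel _ _
  · refine Finset.sum_congr rfl fun l hl => ?_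
    exact actAt_comm n d (Finset.ne_of_mem_erase hl) _ _

/-- The diagonal action as a homomorphism of Lie algebras `𝔤𝔩_n → S(n,d)`. -/
def glAct (n d : ℕ) : Matrix (Fin n) (Fin n) ℚ →ₗ⁅ℚ⁆ SchurAlgebra n d where
  toFun A := ⟨diagAct n d A, diagAct_mem n d A⟩
  map_add' A B := by
    apply Subtype.ext
    simp [diagAct, actAt_add, Finset.sum_add_distrib]
  map_smul' c A := by
    apply Subtype.ext
    simp [diagAct, actAt_smul, Finset.smul_sum]
  map_lie' {A B} := by
    rw [Ring.lie_def]
    exact eq_sub_of_add_eq (Subtype.ext (diagAct_lie n d A B))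

/-- The canonical homomorphism `U(𝔤𝔩_n) → S(n,d)` given by the action on tensor space. -/
def schurRep (n d : ℕ) :
    UniversalEnvelopingAlgebra ℚ (Matrix (Fin n) (Fin n) ℚ) →ₐ[ℚ] SchurAlgebra n d :=
  UniversalEnvelopingAlgebra.lift ℚ (glAct n d)

/-- The roots of type `A_{n-1}`: `ε_i - ε_j` is recorded as the pair `(i, j)`, `i ≠ j`. -/
abbrev Root (n : ℕ) : Type := {p : Fin n × Fin n // p.1 ≠ p.2}

/-- The root vector `x_α` of `𝔤𝔩_n` in `U(𝔤𝔩_n)`: for `α = ε_i - ε_j` it is the matrix unit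
`E_{ij}`. -/
def rootVector (n : ℕ) (α : Root n) :
    UniversalEnvelopingAlgebra ℚ (Matrix (Fin n) (Fin n) ℚ) :=
  UniversalEnvelopingAlgebra.ι ℚ (Matrix.single α.1.1 α.1.2 (1 : ℚ))

/-- The element `H_k` of `U(𝔤𝔩_n)`: the diagonal matrix unit `E_{kk}`. -/
def cartan (n : ℕ) (k : Fin n) : UniversalEnvelopingAlgebra ℚ (Matrix (Fin n) (Fin n) ℚ) :=
  UniversalEnvelopingAlgebra.ι ℚ (Matrix.single k k (1 : ℚ))

/-- Labels of the elements of `G = {x_α | α ∈ Φ} ∪ {H_k | k ≠ k₀}`. -/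
inductive Gen (n : ℕ) (k₀ : Fin n) : Type
  | x (α : Root n) : Gen n k₀
  | H (k : {k : Fin n // k ≠ k₀}) : Gen n k₀

/-- `G` is finite. -/
instance (n : ℕ) (k₀ : Fin n) : Fintype (Gen n k₀) :=
  Fintype.ofEquiv (Root n ⊕ {k : Fin n // k ≠ k₀})
    { toFun := Sum.elim Gen.x Gen.H
      invFun := fun g => match g with
        | Gen.x α => Sum.inl α
        | Gen.H k => Sum.inr k
      left_inv := by rintro (_ | _) <;> rfl
      right_inv := by rintro (_ | _) <;> rfl }

/-- The element of `U(𝔤𝔩_n)` with a given label. -/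
def Gen.val {n : ℕ} {k₀ : Fin n} :
    Gen n k₀ → UniversalEnvelopingAlgebra ℚ (Matrix (Fin n) (Fin n) ℚ)
  | Gen.x α => rootVector n α
  | Gen.H k => cartan n k

/-- The ordered monomial `∏_{g ∈ G} g ^ {a_g}` in `S(n,d)`, the factors being taken in increasing
order for the given total order on `G`. -/
def orderedMonomial {n : ℕ} (d : ℕ) {k₀ : Fin n} (ord : LinearOrder (Gen n k₀))
    (a : Gen n k₀ → ℕ) : SchurAlgebra n d :=
  (((Finset.univ : Finset (Gen n k₀)).sort (fun g h => ord.le g h)).map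
    (fun g => schurRep n d g.val ^ a g)).prod

end

/-! The identity matrix together with `G` is a basis of the matrix algebra, so the pure tensors of
these elements, indexed by maps `f` from the places to `Option (Gen n k₀)` with `none` standing for
the identity, form a basis of the endomorphisms of tensor space. Filter it by weight, the number of
places not occupied by the identity. A word of length `r` in `G` has no component of weight above
`r`, and its weight `r` part is supported exactly on the `f` with the same content as the word, with
positive coefficients (`tensorBasis_repr_wordAct`). Monomials of degree at most `d` thus have
disjoint leading terms and are independent. Conversely, the coefficients of an element of the Schur
algebra are constant on orbits of place permutations, and the orbits correspond to the exponents `a`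
of total at most `d`; this bounds the dimension (`finrank_schurAlgebra_le`). -/

open scoped TensorProduct

noncomputable section

attribute [local instance 100] LieRing.ofAssociativeRing

open Module

/-! ### Pure tensors as a basis of the endomorphism algebra -/

section TensorBasis

variable {n d : ℕ} {κ : Type*} [Fintype κ] (B : Basis κ ℚ (Matrix (Fin n) (Fin n) ℚ))

/-- The operator `M₁ ⊗ ⋯ ⊗ M_d` on tensor space. -/
def mapMatrix (n d : ℕ) (M : Fin d → Matrix (Fin n) (Fin n) ℚ) : Module.End ℚ (TensorSpace n d) :=
  PiTensorProduct.map fun k => Matrix.toLin' (M k)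

theorem mapMatrix_expand (M : Fin d → Matrix (Fin n) (Fin n) ℚ) :
    mapMatrix n d M
      = ∑ f : Fin d → κ, (∏ k, B.repr (M k) (f k)) • mapMatrix n d (fun k => B (f k)) := by
  have h : (fun k => Matrix.toLin' (M k))
      = fun k => ∑ o, B.repr (M k) o • Matrix.toLin' (B o) := by
    funext k
    conv_lhs => rw [← B.sum_repr (M k)]
    rw [map_sum]
    simp_rw [map_smul]
  rw [mapMatrix, h, ← PiTensorProduct.mapMultilinear_apply, MultilinearMap.map_sum]
  refine Finset.sum_congr rfl fun f _ => ?_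
  rw [MultilinearMap.map_smul_univ, PiTensorProduct.mapMultilinear_apply]
  rfl

/-- The standard basis of tensor space. -/
def tensorSpaceBasis (n d : ℕ) : Basis (Fin d → Fin n) ℚ (TensorSpace n d) :=
  Basis.piTensorProduct fun _ => Pi.basisFun ℚ (Fin n)

theorem tensorSpaceBasis_linearMap (p : (Fin d → Fin n) × (Fin d → Fin n)) :
    (tensorSpaceBasis n d).linearMap (tensorSpaceBasis n d) p
      = mapMatrix n d fun k => Matrix.single (p.1 k) (p.2 k) 1 := by
  refine (tensorSpaceBasis n d).ext fun u => ?_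
  rw [Basis.linearMap_apply_apply, tensorSpaceBasis, Basis.piTensorProduct_apply,
    Basis.piTensorProduct_apply, mapMatrix, PiTensorProduct.map_tprod]
  split_ifs with h
  · subst h
    congr 1
    funext k
    ext i
    simp [Matrix.single_apply, Pi.single_apply, eq_comm]
  · obtain ⟨k, hk⟩ := Function.ne_iff.mp h
    refine ((PiTensorProduct.tprod ℚ).map_coord_zero k ?_).symm
    ext i
    simp [hk]

instance tensorSpace_finite : Module.Finite ℚ (TensorSpace n d) :=
  Module.Finite.of_basis (tensorSpaceBasis n d)

/-- Tensors of matrix units span, and each expands multilinearly in `B`. A dimension count then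
replaces a proof of independence. -/
theorem mapMatrix_span :
    ⊤ ≤ Submodule.span ℚ (Set.range fun f : Fin d → κ => mapMatrix n d fun k => B (f k)) := by
  rw [← ((tensorSpaceBasis n d).linearMap (tensorSpaceBasis n d)).span_eq, Submodule.span_le]
  rintro _ ⟨p, rfl⟩
  rw [tensorSpaceBasis_linearMap, mapMatrix_expand B]
  exact Submodule.sum_mem _ fun f _ =>
    Submodule.smul_mem _ _ (Submodule.subset_span ⟨f, rfl⟩)

theorem card_eq_finrank_end (B : Basis κ ℚ (Matrix (Fin n) (Fin n) ℚ)) :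
    Fintype.card (Fin d → κ) = finrank ℚ (Module.End ℚ (TensorSpace n d)) := by
  have h := finrank_eq_card_basis B
  have h' := finrank_eq_card_basis (tensorSpaceBasis n d)
  rw [finrank_matrix] at h
  simp only [Fintype.card_fin, finrank_self, mul_one] at h
  refine Eq.trans ?_ (finrank_linearMap ℚ ℚ (TensorSpace n d) (TensorSpace n d)).symm
  rw [Fintype.card_fun, ← h, h']
  simp [mul_pow]

/-- The basis of `End(V^{⊗ d})` of pure tensors of elements of a basis of `End V`. -/
def tensorBasis (d : ℕ) : Basis (Fin d → κ) ℚ (Module.End ℚ (TensorSpace n d)) :=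
  basisOfTopLeSpanOfCardEqFinrank (fun f : Fin d → κ => mapMatrix n d fun k => B (f k))
    (mapMatrix_span B) (card_eq_finrank_end B)

theorem tensorBasis_apply (f : Fin d → κ) :
    tensorBasis B d f = mapMatrix n d fun k => B (f k) := by
  simp [tensorBasis]

theorem tensorBasis_repr_mapMatrix (M : Fin d → Matrix (Fin n) (Fin n) ℚ) (f : Fin d → κ) :
    (tensorBasis B d).repr (mapMatrix n d M) f = ∏ k, B.repr (M k) (f k) := by
  rw [mapMatrix_expand B]
  simp_rw [← tensorBasis_apply]
  rw [Basis.repr_sum_self]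

theorem actAt_mul_mapMatrix (k : Fin d) (A : Matrix (Fin n) (Fin n) ℚ)
    (M : Fin d → Matrix (Fin n) (Fin n) ℚ) :
    actAt n d k (Matrix.toLin' A) * mapMatrix n d M
      = mapMatrix n d (Function.update M k (A * M k)) := by
  apply PiTensorProduct.ext
  refine MultilinearMap.ext fun v => ?_
  simp only [mapMatrix, LinearMap.compMultilinearMap_apply, Module.End.mul_apply,
    PiTensorProduct.map_tprod, actAt_tprod]
  congr 1
  funext i
  by_cases h : i = k
  · subst h; simp
  · simp [h]

theorem tensorBasis_repr_perm {s : Module.End ℚ (TensorSpace n d)} (hs : s ∈ SchurAlgebra n d)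
    (σ : Equiv.Perm (Fin d)) (f : Fin d → κ) :
    (tensorBasis B d).repr s (f ∘ σ) = (tensorBasis B d).repr s f := by
  classical
  have hcomm : ∀ M : Fin d → Matrix (Fin n) (Fin n) ℚ,
      placePerm n d σ * mapMatrix n d M = mapMatrix n d (M ∘ σ.symm) * placePerm n d σ :=
    fun M => (PiTensorProduct.map_comp_reindex_eq (fun k => Matrix.toLin' (M k)) σ).symm
  have hs' : placePerm n d σ * s = s * placePerm n d σ :=
    (Subalgebra.mem_centralizer_iff ℚ).mp hs _ ⟨σ, rfl⟩
  -- Conjugation by the place permutation permutes the basis tensors and fixes `s`.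
  let e := PiTensorProduct.reindex ℚ (fun _ : Fin d => Fin n → ℚ) σ
  let c : Module.End ℚ (TensorSpace n d) →ₗ[ℚ] Module.End ℚ (TensorSpace n d) :=
    LinearMap.mulRight ℚ (e.symm : Module.End ℚ (TensorSpace n d)) ∘ₗ
      LinearMap.mulLeft ℚ (placePerm n d σ)
  have hinv : placePerm n d σ * (e.symm : Module.End ℚ (TensorSpace n d)) = 1 :=
    LinearMap.ext fun x => e.apply_symm_apply x
  have hc : ∀ s, (tensorBasis B d).repr (c s) f = (tensorBasis B d).repr s (f ∘ σ) := by
    intro s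
    have h : (tensorBasis B d).coord f ∘ₗ c = (tensorBasis B d).coord (f ∘ σ) := by
      refine (tensorBasis B d).ext fun u => ?_
      have : c (tensorBasis B d u) = tensorBasis B d (u ∘ σ.symm) := by
        rw [tensorBasis_apply, tensorBasis_apply]
        change placePerm n d σ * _ * (e.symm : Module.End ℚ (TensorSpace n d)) = _
        rw [hcomm, mul_assoc, hinv, mul_one]
        rfl
      simp only [LinearMap.comp_apply, this, Basis.coord_apply, Basis.repr_self,
        Finsupp.single_apply]
      congr 1
      rw [Equiv.comp_symm_eq]
    exact LinearMap.congr_fun h s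
  have hcs : c s = s := by
    change placePerm n d σ * _ * (e.symm : Module.End ℚ (TensorSpace n d)) = _
    rw [hs', mul_assoc, hinv, mul_one]
  rw [← hc, hcs]

variable [DecidableEq κ]

theorem tensorBasis_repr_actAt_mul (k : Fin d) (A : Matrix (Fin n) (Fin n) ℚ)
    (s : Module.End ℚ (TensorSpace n d)) (f : Fin d → κ) :
    (tensorBasis B d).repr (actAt n d k (Matrix.toLin' A) * s) f
      = ∑ o, B.repr (A * B o) (f k) * (tensorBasis B d).repr s (Function.update f k o) := by
  let φ : Module.End ℚ (TensorSpace n d) →ₗ[ℚ] ℚ :=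
    (tensorBasis B d).coord f ∘ₗ LinearMap.mulLeft ℚ (actAt n d k (Matrix.toLin' A))
  let ψ : Module.End ℚ (TensorSpace n d) →ₗ[ℚ] ℚ :=
    ∑ o, B.repr (A * B o) (f k) • (tensorBasis B d).coord (Function.update f k o)
  have h : φ = ψ := by
    refine (tensorBasis B d).ext fun u => ?_
    simp only [φ, ψ, LinearMap.comp_apply, LinearMap.mulLeft_apply, Basis.coord_apply,
      LinearMap.sum_apply, LinearMap.smul_apply, smul_eq_mul, Basis.repr_self]
    rw [tensorBasis_apply, actAt_mul_mapMatrix, tensorBasis_repr_mapMatrix,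
      ← Finset.mul_prod_erase _ _ (Finset.mem_univ k)]
    -- Places other than `k` are untouched, so they contribute the indicator that `u` and `f` agree
    -- off `k`.
    have e : ∏ i ∈ Finset.univ.erase k,
        B.repr (Function.update (fun k => B (u k)) k (A * B (u k)) i) (f i)
        = if ∀ i, i ≠ k → u i = f i then 1 else 0 := by
      split_ifs with h
      · refine Finset.prod_eq_one fun i hi => ?_
        have hi' := Finset.ne_of_mem_erase hi
        simp [hi', h i hi']
      · push Not at h
        obtain ⟨i, hi, hne⟩ := h
        refine Finset.prod_eq_zero (Finset.mem_erase.mpr ⟨hi, Finset.mem_univ i⟩) ?_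
        simp [hi, hne]
    rw [e, Function.update_self]
    rw [Finset.sum_eq_single (u k)]
    · congr 1
      rw [Finsupp.single_apply]
      congr 1
      rw [eq_comm (a := u), Function.update_eq_iff]
      simp [eq_comm]
    · intro o _ ho
      rw [Finsupp.single_eq_of_ne, mul_zero]
      intro h
      apply ho
      simpa using congrFun h k
    · simp
  exact (LinearMap.congr_fun h s).trans (by simp [ψ])

theorem tensorBasis_repr_diagAct_mul (A : Matrix (Fin n) (Fin n) ℚ)
    (s : Module.End ℚ (TensorSpace n d)) (f : Fin d → κ) :
    (tensorBasis B d).repr (diagAct n d A * s) f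
      = ∑ k, ∑ o, B.repr (A * B o) (f k) * (tensorBasis B d).repr s (Function.update f k o) := by
  simp only [diagAct, Finset.sum_mul, map_sum, Finsupp.coe_finsetSum, Finset.sum_apply,
    tensorBasis_repr_actAt_mul]

end TensorBasis

/-! ### Orbits of place permutations and multiplicities of values -/

section FiberCard

variable {d : ℕ} {κ : Type*} [DecidableEq κ]

/-- The number of places of `f` with value `o`. -/
def fiberCard (f : Fin d → κ) (o : κ) : ℕ := Fintype.card {k // f k = o}

/-- Bijections between corresponding fibres glue to a permutation of the places. -/
theorem exists_perm_of_fiberCard_eq {f f' : Fin d → κ} (h : fiberCard f = fiberCard f') :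
    ∃ σ : Equiv.Perm (Fin d), f' = f ∘ σ := by
  have e : ∀ o, {k // f' k = o} ≃ {k // f k = o} := fun o =>
    (Fintype.equivOfCardEq (congrFun h o)).symm
  refine ⟨(Equiv.sigmaFiberEquiv f').symm.trans
    ((Equiv.sigmaCongrRight e).trans (Equiv.sigmaFiberEquiv f)), ?_⟩
  funext k
  exact (e (f' k) ⟨k, rfl⟩).2.symm

theorem exists_fiberCard_eq [Fintype κ] {a : κ → ℕ} (h : ∑ o, a o = d) :
    ∃ f : Fin d → κ, fiberCard f = a := by
  have e : Fin d ≃ Σ o, Fin (a o) := Fintype.equivOfCardEq (by simp [h])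
  refine ⟨fun k => (e k).1, funext fun o => ?_⟩
  have e' : {k // (e k).1 = o} ≃ {p : Σ o, Fin (a o) // p.1 = o} :=
    e.subtypeEquiv fun _ => Iff.rfl
  rw [fiberCard, Fintype.card_congr (e'.trans (Equiv.sigmaSubtype o)), Fintype.card_fin]

theorem sum_fiberCard [Fintype κ] (f : Fin d → κ) : ∑ o, fiberCard f o = d := by
  simpa [fiberCard] using Fintype.card_congr (Equiv.sigmaFiberEquiv f)

theorem fiberCard_update (f : Fin d → κ) (k : Fin d) (o x : κ) :
    fiberCard (Function.update f k o) x + (if f k = x then 1 else 0)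
      = fiberCard f x + (if o = x then 1 else 0) := by
  simp only [fiberCard, Fintype.card_subtype, Finset.card_filter]
  rw [← Finset.add_sum_erase _ _ (Finset.mem_univ k),
    ← Finset.add_sum_erase _ (fun i => if f i = x then 1 else 0) (Finset.mem_univ k)]
  have : ∑ i ∈ Finset.univ.erase k, (if Function.update f k o i = x then 1 else 0)
      = ∑ i ∈ Finset.univ.erase k, (if f i = x then 1 else 0) :=
    Finset.sum_congr rfl fun i hi => by simp [Finset.ne_of_mem_erase hi]
  rw [this, Function.update_self]
  omega

end FiberCard

/-! ### Weight filtration and leading terms of words -/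

section Words

variable {n d : ℕ} {γ : Type*} [Fintype γ] [DecidableEq γ]

/-- The number of places of `f` with a value different from `none`. -/
def weight (f : Fin d → Option γ) : ℕ := ∑ g, fiberCard f (some g)

theorem fiberCard_none_add_weight (f : Fin d → Option γ) : fiberCard f none + weight f = d := by
  rw [weight, ← Fintype.sum_option, sum_fiberCard]

theorem weight_update (f : Fin d → Option γ) (k : Fin d) (o : Option γ) :
    weight f + (if f k = none then 1 else 0)
      = weight (Function.update f k o) + (if o = none then 1 else 0) := by
  have h₁ := fiberCard_none_add_weight f
  have h₂ := fiberCard_none_add_weight (Function.update f k o)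
  have h₃ := fiberCard_update f k o none
  omega

variable (B : Basis (Option γ) ℚ (Matrix (Fin n) (Fin n) ℚ))

/-- The operator by which a word in the basis elements `B (some g)` acts on tensor space. -/
def wordAct (d : ℕ) (l : List γ) : Module.End ℚ (TensorSpace n d) :=
  (l.map fun g => diagAct n d (B (some g))).prod

omit [Fintype γ] [DecidableEq γ] in
theorem wordAct_cons (g : γ) (l : List γ) :
    wordAct B d (g :: l) = diagAct n d (B (some g)) * wordAct B d l := by
  simp [wordAct]

variable {B}

theorem tensorBasis_repr_one (hB : B none = 1) (f : Fin d → Option γ) :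
    (tensorBasis B d).repr 1 f = if weight f = 0 then 1 else 0 := by
  have h1 : (1 : Module.End ℚ (TensorSpace n d)) = tensorBasis B d fun _ => none := by
    rw [tensorBasis_apply]
    simp only [mapMatrix, hB, Matrix.toLin'_one]
    exact PiTensorProduct.map_id.symm
  rw [h1, Basis.repr_self, Finsupp.single_apply]
  congr 1
  simp only [weight, Finset.sum_eq_zero_iff, Finset.mem_univ, true_imp_iff, fiberCard,
    Fintype.card_eq_zero_iff, isEmpty_subtype, eq_iff_iff]
  constructor
  · rintro rfl g k
    simp
  · intro h
    funext k
    cases hk : f k with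
    | none => rfl
    | some g => exact absurd hk (h g k)

/-- Each letter alters one place at a time, hence raises the weight by at most one. -/
theorem tensorBasis_repr_wordAct_of_lt (hB : B none = 1) (l : List γ) (f : Fin d → Option γ)
    (hf : l.length < weight f) : (tensorBasis B d).repr (wordAct B d l) f = 0 := by
  induction l generalizing f with
  | nil =>
    have h : weight f ≠ 0 := by simpa using hf.ne'
    simp [wordAct, tensorBasis_repr_one hB, h]
  | cons g l ih =>
    rw [wordAct_cons, tensorBasis_repr_diagAct_mul]
    refine Finset.sum_eq_zero fun k _ => Finset.sum_eq_zero fun o _ => ?_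
    rw [ih, mul_zero]
    have := weight_update f k o
    rw [List.length_cons] at hf
    split_ifs at this <;> omega

/-- In top weight the new letter must land on a place where `wordAct B d l` has the identity; other
contributions come from coefficients of too large a weight. -/
theorem tensorBasis_repr_wordAct_cons (hB : B none = 1) (g : γ) (l : List γ)
    (f : Fin d → Option γ) (hf : weight f = l.length + 1) :
    (tensorBasis B d).repr (wordAct B d (g :: l)) f
      = ∑ k with f k = some g,
          (tensorBasis B d).repr (wordAct B d l) (Function.update f k none) := by
  rw [wordAct_cons, tensorBasis_repr_diagAct_mul, Finset.sum_filter]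
  refine Finset.sum_congr rfl fun k _ => ?_
  rw [Fintype.sum_option, Finset.sum_eq_zero, add_zero, hB, mul_one, Basis.repr_self,
    Finsupp.single_apply]
  · simp [eq_comm]
  · intro h _
    rw [tensorBasis_repr_wordAct_of_lt hB, mul_zero]
    have := weight_update f k (some h)
    simp only [reduceCtorEq, if_false] at this
    omega

omit [Fintype γ] in
theorem fiberCard_update_none {f : Fin d → Option γ} {k : Fin d} {g : γ} (hk : f k = some g)
    (l : List γ) :
    (∀ x, fiberCard (Function.update f k none) (some x) = l.count x)
      ↔ ∀ x, fiberCard f (some x) = (g :: l).count x := by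
  refine forall_congr' fun x => ?_
  have := fiberCard_update f k none (some x)
  simp only [hk, Option.some.injEq, reduceCtorEq, if_false] at this
  simp only [List.count_cons, beq_iff_eq]
  omega

/-- The leading coefficients of the operator of a word. -/
theorem tensorBasis_repr_wordAct (hB : B none = 1) (l : List γ) (f : Fin d → Option γ)
    (hf : weight f = l.length) :
    ((∀ g, fiberCard f (some g) = l.count g) → 0 < (tensorBasis B d).repr (wordAct B d l) f) ∧
    ((¬ ∀ g, fiberCard f (some g) = l.count g) → (tensorBasis B d).repr (wordAct B d l) f = 0) := by
  induction l generalizing f with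
  | nil =>
    have h : weight f = 0 := hf
    refine ⟨fun _ => by simp [wordAct, tensorBasis_repr_one hB, h], fun h' => (h' fun g => ?_).elim⟩
    simpa using Finset.sum_eq_zero_iff.mp h g (Finset.mem_univ g)
  | cons g l ih =>
    have hw : ∀ k, f k = some g → weight (Function.update f k none) = l.length := by
      intro k hk
      have := weight_update f k none
      simp only [hk, reduceCtorEq, if_false, if_true] at this
      rw [List.length_cons] at hf
      omega
    rw [tensorBasis_repr_wordAct_cons hB g l f hf]
    constructor
    · intro h
      refine Finset.sum_pos (fun k hk => ?_) ?_
      · have hk := (Finset.mem_filter.mp hk).2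
        exact (ih _ (hw k hk)).1 ((fiberCard_update_none hk l).mpr h)
      · have hg : 0 < fiberCard f (some g) := by rw [h g]; simp
        obtain ⟨k, hk⟩ := Fintype.card_pos_iff.mp hg
        exact ⟨k, by simp [hk]⟩
    · intro h
      refine Finset.sum_eq_zero fun k hk => ?_
      have hk := (Finset.mem_filter.mp hk).2
      exact (ih _ (hw k hk)).2 fun h' => h ((fiberCard_update_none hk l).mp h')

end Words

/-! ### Dimension bound and linear independence -/

section Monomials

variable {n d : ℕ} {γ : Type*} [Fintype γ] [DecidableEq γ]

theorem exists_fiberCard_some_eq {a : γ → ℕ} (ha : ∑ g, a g ≤ d) :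
    ∃ f : Fin d → Option γ, ∀ g, fiberCard f (some g) = a g := by
  obtain ⟨f, hf⟩ := exists_fiberCard_eq (d := d)
    -- The identity fills the remaining `d - ∑ g, a g` places.
    (a := fun o : Option γ => o.elim (d - ∑ g, a g) a) (by
      rw [Fintype.sum_option]
      simpa using Nat.sub_add_cancel ha)
  exact ⟨f, fun g => by rw [hf]; rfl⟩

instance finite_degree_le : Finite {a : γ → ℕ // ∑ g, a g ≤ d} := by
  refine Finite.of_injective
    (fun a g => (⟨a.1 g, Nat.lt_succ_of_le ((Finset.single_le_sum (fun _ _ => Nat.zero_le _)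
      (Finset.mem_univ g)).trans a.2)⟩ : Fin (d + 1))) fun a b h => Subtype.ext (funext fun g => ?_)
  exact congrArg Fin.val (congrFun h g)

/-- A map from `{1, …, d}` which takes each value `some g` exactly `a g` times. -/
def placement (a : {a : γ → ℕ // ∑ g, a g ≤ d}) : Fin d → Option γ :=
  (exists_fiberCard_some_eq a.2).choose

theorem fiberCard_placement (a : {a : γ → ℕ // ∑ g, a g ≤ d}) (g : γ) :
    fiberCard (placement a) (some g) = a.1 g :=
  (exists_fiberCard_some_eq a.2).choose_spec g

theorem weight_placement (a : {a : γ → ℕ // ∑ g, a g ≤ d}) :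
    weight (placement a) = ∑ g, a.1 g :=
  Finset.sum_congr rfl fun g _ => fiberCard_placement a g

theorem exists_perm_placement (f : Fin d → Option γ) :
    ∃ (a : {a : γ → ℕ // ∑ g, a g ≤ d}) (σ : Equiv.Perm (Fin d)), f = placement a ∘ σ := by
  let a : {a : γ → ℕ // ∑ g, a g ≤ d} :=
    ⟨fun g => fiberCard f (some g), (Nat.le_add_left _ _).trans (fiberCard_none_add_weight f).le⟩
  refine ⟨a, exists_perm_of_fiberCard_eq (funext fun o => ?_)⟩
  cases o with
  | none =>
    have h₁ := fiberCard_none_add_weight f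
    have h₂ := fiberCard_none_add_weight (placement a)
    rw [weight_placement] at h₂
    change _ + weight f = d at h₂
    omega
  | some g => exact fiberCard_placement a g

variable {B : Basis (Option γ) ℚ (Matrix (Fin n) (Fin n) ℚ)}

instance schurAlgebra_finite : Module.Finite ℚ (SchurAlgebra n d) :=
  inferInstanceAs (Module.Finite ℚ (Subalgebra.toSubmodule (SchurAlgebra n d)))

theorem finrank_schurAlgebra_le (B : Basis (Option γ) ℚ (Matrix (Fin n) (Fin n) ℚ)) :
    finrank ℚ (SchurAlgebra n d) ≤ Nat.card {a : γ → ℕ // ∑ g, a g ≤ d} := by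
  have := Fintype.ofFinite {a : γ → ℕ // ∑ g, a g ≤ d}
  let e : SchurAlgebra n d →ₗ[ℚ] ({a : γ → ℕ // ∑ g, a g ≤ d} → ℚ) :=
    LinearMap.pi fun a => (tensorBasis B d).coord (placement a) ∘ₗ (SchurAlgebra n d).val.toLinearMap
  have he : Function.Injective e := by
    rw [injective_iff_map_eq_zero]
    intro s hs
    refine Subtype.ext ((tensorBasis B d).ext_elem fun f => ?_)
    obtain ⟨a, σ, rfl⟩ := exists_perm_placement f
    rw [tensorBasis_repr_perm B s.2]
    simpa [e] using congrFun hs a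
  rw [Nat.card_eq_fintype_card, ← finrank_fintype_fun_eq_card ℚ]
  exact LinearMap.finrank_le_finrank_of_injective he

/-- Only the content of each word affects its leading term, so the order of the letters is
arbitrary. -/
theorem linearIndependent_wordAct (hB : B none = 1)
    (w : {a : γ → ℕ // ∑ g, a g ≤ d} → List γ) (hw : ∀ a g, (w a).count g = a.1 g) :
    LinearIndependent ℚ fun a => wordAct B d (w a) := by
  have := Fintype.ofFinite {a : γ → ℕ // ∑ g, a g ≤ d}
  have hlen : ∀ a, (w a).length = ∑ g, a.1 g := fun a => by
    rw [← Multiset.coe_card, ← Multiset.sum_count_eq_card (s := Finset.univ) (by simp)]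
    exact Finset.sum_congr rfl fun g _ => (Multiset.coe_count g _).trans (hw a g)
  refine (@Fintype.linearIndependent_iff _ ℚ (Module.End ℚ (TensorSpace n d)) _
    LinearMap.addCommGroup LinearMap.module _ _).mpr fun c hc => ?_
  by_contra! hne
  -- At the leading place of an `a` of maximal degree in the relation, no other term contributes.
  obtain ⟨a, ha, hmax⟩ := Finset.exists_max_image {a | c a ≠ 0} (fun a => ∑ g, a.1 g)
    (by simpa [Finset.Nonempty] using hne)
  simp only [Finset.mem_filter, Finset.mem_univ, true_and] at ha hmax
  have h := congrArg (fun s => (tensorBasis B d).repr s (placement a)) hc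
  simp only [map_sum, map_smul, Finsupp.coe_finsetSum, Finset.sum_apply, Finsupp.smul_apply,
    smul_eq_mul, map_zero, Finsupp.coe_zero, Pi.zero_apply] at h
  rw [Finset.sum_eq_single a] at h
  · have hpos := (tensorBasis_repr_wordAct hB (w a) (placement a)
      (by rw [weight_placement, hlen])).1 fun g => by rw [fiberCard_placement, hw]
    exact (mul_ne_zero ha hpos.ne') h
  · intro b _ hba
    by_cases hb : c b = 0
    · rw [hb, zero_mul]
    rcases (hmax b hb).lt_or_eq with hlt | heq
    · rw [tensorBasis_repr_wordAct_of_lt hB, mul_zero]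
      rwa [weight_placement, hlen]
    · rw [(tensorBasis_repr_wordAct hB (w b) (placement a)
        (by rw [weight_placement, hlen, heq])).2, mul_zero]
      intro hall
      refine hba (Subtype.ext (funext fun g => ?_))
      rw [← hw b g, ← hall g, fiberCard_placement]
  · simp

end Monomials

/-! ### The generators and the identity as a basis of matrices -/

section Generators

variable {n : ℕ} (k₀ : Fin n)

/-- The matrix with a given label. -/
def Gen.matrix {k₀ : Fin n} : Gen n k₀ → Matrix (Fin n) (Fin n) ℚ
  | Gen.x α => Matrix.single α.1.1 α.1.2 1
  | Gen.H k => Matrix.single k.1 k.1 1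

/-- Coordinates of matrices with respect to the identity matrix and the elements of `G`. -/
def genCoord : Matrix (Fin n) (Fin n) ℚ ≃ₗ[ℚ] (Option (Gen n k₀) → ℚ) where
  toFun M
    | none => M k₀ k₀
    | some (Gen.x α) => M α.1.1 α.1.2
    -- With `E_{k₀k₀}` omitted, the identity must carry the coefficient `M k₀ k₀`, which is then
    -- subtracted from the other diagonal entries.
    | some (Gen.H k) => M k k - M k₀ k₀
  map_add' M N := by
    funext o
    rcases o with _ | _ | _ <;> simp [add_sub_add_comm]
  map_smul' c M := by
    funext o
    rcases o with _ | _ | _ <;> simp [mul_sub]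
  invFun c i j :=
    if h : i = j then (if h' : i = k₀ then c none else c none + c (some (Gen.H ⟨i, h'⟩)))
    else c (some (Gen.x ⟨(i, j), h⟩))
  left_inv M := by
    ext i j
    by_cases h : i = j
    · subst h
      by_cases h' : i = k₀
      · subst h'; simp
      · simp [h']
    · simp [h]
  right_inv c := by
    funext o
    rcases o with _ | α | k
    · simp
    · simp [α.2]
    · simp [k.2]

@[simp]
theorem genCoord_none (M : Matrix (Fin n) (Fin n) ℚ) : genCoord k₀ M none = M k₀ k₀ := rfl

@[simp]
theorem genCoord_x (M : Matrix (Fin n) (Fin n) ℚ) (α : Root n) :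
    genCoord k₀ M (some (Gen.x α)) = M α.1.1 α.1.2 := rfl

@[simp]
theorem genCoord_H (M : Matrix (Fin n) (Fin n) ℚ) (k : {k : Fin n // k ≠ k₀}) :
    genCoord k₀ M (some (Gen.H k)) = M k k - M k₀ k₀ := rfl

/-- The basis of `𝔤𝔩_n` formed by the identity matrix and the elements of `G`. -/
def genBasis : Basis (Option (Gen n k₀)) ℚ (Matrix (Fin n) (Fin n) ℚ) :=
  Basis.ofEquivFun (genCoord k₀)

theorem genBasis_none : genBasis k₀ none = 1 := by
  classical
  rw [genBasis, Basis.coe_ofEquivFun, LinearEquiv.symm_apply_eq]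
  funext o
  rcases o with _ | α | k
  · simp
  · simp [α.2]
  · simp

theorem genBasis_some (g : Gen n k₀) : genBasis k₀ (some g) = g.matrix := by
  classical
  rw [genBasis, Basis.coe_ofEquivFun, LinearEquiv.symm_apply_eq]
  funext o
  rcases o with _ | α | k <;> rcases g with β | l <;>
    · simp only [genCoord_none, genCoord_x, genCoord_H, Gen.matrix, Matrix.single_apply,
        Pi.single_apply]
      grind

theorem schurRep_val (d : ℕ) {k₀ : Fin n} (g : Gen n k₀) :
    (schurRep n d g.val : Module.End ℚ (TensorSpace n d)) = diagAct n d g.matrix := by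
  cases g <;> simp [schurRep, Gen.val, rootVector, cartan, Gen.matrix] <;> rfl

theorem prod_map_pow_eq_wordAct (d : ℕ) {k₀ : Fin n} (a : Gen n k₀ → ℕ) (l : List (Gen n k₀)) :
    ((l.map fun g => schurRep n d g.val ^ a g).prod : Module.End ℚ (TensorSpace n d))
      = wordAct (genBasis k₀) d (l.flatMap fun g => List.replicate (a g) g) := by
  induction l with
  | nil => simp [wordAct]
  | cons g l ih =>
    simp [wordAct, genBasis_some] at ih ⊢
    rw [schurRep_val, ih]

theorem count_flatMap_replicate {α : Type*} [DecidableEq α] (a : α → ℕ) {l : List α}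
    (hl : l.Nodup) {g : α} (hg : g ∈ l) :
    (l.flatMap fun g => List.replicate (a g) g).count g = a g := by
  rw [List.count_flatMap]
  have : (List.count g ∘ fun g => List.replicate (a g) g) = fun x => if x = g then a g else 0 := by
    funext x
    by_cases h : x = g
    · subst h; simp
    · simp [List.count_replicate, h]
  rw [this, ← List.sum_toFinset _ hl]
  simp [hg]

end Generators

end

theorem theorem2 (n d : ℕ) (k₀ : Fin n) (ord : LinearOrder (Gen n k₀)) :
    ∃ b : Module.Basis {a : Gen n k₀ → ℕ // ∑ g, a g ≤ d} ℚ (SchurAlgebra n d),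
      ∀ a, b a = orderedMonomial d ord a.1 := by
  classical
  have := Fintype.ofFinite {a : Gen n k₀ → ℕ // ∑ g, a g ≤ d}
  have hli : LinearIndependent ℚ
      fun a : {a : Gen n k₀ → ℕ // ∑ g, a g ≤ d} => orderedMonomial d ord a.1 := by
    refine LinearIndependent.of_comp (SchurAlgebra n d).val.toLinearMap ?_
    have h := linearIndependent_wordAct (d := d) (genBasis_none k₀)
      (fun a => ((Finset.univ : Finset (Gen n k₀)).sort (fun g h => ord.le g h)).flatMap
        fun g => List.replicate (a.1 g) g)
      (fun a g => count_flatMap_replicate a.1 (Finset.sort_nodup _ _) (by simp))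
    rw [← funext fun a : {a : Gen n k₀ → ℕ // ∑ g, a g ≤ d} => prod_map_pow_eq_wordAct d a.1 _] at h
    exact h
  have : Nonempty {a : Gen n k₀ → ℕ // ∑ g, a g ≤ d} := ⟨⟨0, by simp⟩⟩
  have hcard : Fintype.card {a : Gen n k₀ → ℕ // ∑ g, a g ≤ d} = Module.finrank ℚ (SchurAlgebra n d) :=
    le_antisymm hli.fintype_card_le_finrank
      (by simpa using finrank_schurAlgebra_le (d := d) (genBasis k₀))
  exact ⟨basisOfLinearIndependentOfCardEqFinrank hli hcard, fun a => by simp⟩
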